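/- For $n\ge 4$ let $T_n^*$ be the tree with vertices $v_0,v_1,\ldots,v_{n-1}$ and edges $v_0v_1,\ldots,v_0v_{n-3},\ v_{n-3}v_{n-2},\ v_{n-2}v_{n-1}$, and let $ex(p;T_n^*)$ be the maximal number of edges in a simple graph on $p$ vertices that does not contain $T_n^*$ as a (not necessarily induced) subgraph. Let $p,n$ be positive integers with $6\le n\le 10$ and $p\ge n$, and let $r\in\{0,1,\ldots,n-2\}$ be given by $p\equiv r\pmod{n-1}$. (i) If $n\in\{6,7\}$, then $ex(p;T_n^*)=\dfrac{(n-2)p-r(n-1-r)}2$. (ii) If $n\in\{8,9\}$, then $$ex(p;T_n^*)=\begin{cases}\dfrac{(n-2)p-r(n-1-r)}2&\text{if } r\neq n-5,\\[2mm] \dfrac{(n-2)(p-2)}2+1&\text{if } r=n-5.\end{cases}$$ (iii) If $n=10$, then $$ex(p;T_n^*)=\begin{cases}4p-\dfrac{r(9-r)}2&\text{if } r\notin\{4,5\},\\[2mm] 4p-7&\text{if } r=5,\\ 4p-9&\text{if } r=4.\end{cases}$$ -/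

import Mathlib

/-- The graph `T_n^*` (meaningful for `n ≥ 4`): the tree on the vertices `v_0, …, v_{n-1}` whose
edges are `v_0 v_j` for `1 ≤ j ≤ n - 3`, together with `v_{n-3} v_{n-2}` and `v_{n-2} v_{n-1}`.
`SimpleGraph.fromRel` symmetrizes the listed relation. -/
def TStar (n : ℕ) : SimpleGraph (Fin n) :=
  SimpleGraph.fromRel fun i j =>
    ((i : ℕ) = 0 ∧ 1 ≤ (j : ℕ) ∧ (j : ℕ) + 3 ≤ n) ∨
    ((i : ℕ) + 3 = n ∧ (j : ℕ) + 2 = n) ∨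
    ((i : ℕ) + 2 = n ∧ (j : ℕ) + 1 = n)

/-! Put d = n - 3. A copy of the tree is a spider: a centre with a leg of length three and d - 1
further neighbours. On s vertices the quantity to minimise is (d + 1)s minus the degree sum, and
`spiderDefect` is its minimum. Upper bound: the defect is subadditive, so it is enough to peel off
nonempty closed sets that obey the bound (`exists_adjClosed_sum_degree_le`). If all degrees are
below d there is enough slack at once. Otherwise take v of maximum degree. Without a spider, every
vertex at distance two from v has all its neighbours in N(v). Hence the ball of radius two is
closed, and all its edges meet N(v); counting them from N(v) bounds the degree sum when deg v is at
least d + 2, d + 1 or d. Lower bound: copies of K_{d+2} and one K_r have defect r(d + 2 - r). The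
exceptional residues come from K_{d,d} for d ≥ 5, of defect 2d, and, for d = 7, from K_{6,7} plus an
edge, of defect 18. -/

namespace SimpleGraph

open Finset

/-! ### Copies of the tree as spiders -/

section Characterization

variable {V W : Type*} [Fintype V] [DecidableEq V] [Fintype W] [DecidableEq W]

/-- `G` contains a spider: a centre `c` with a leg `c - x - y - z` of length three and at least
`d - 1` further neighbours of `c`. -/
def HasSpider (G : SimpleGraph V) [DecidableRel G.Adj] (d : ℕ) : Prop :=
  ∃ c x y z, G.Adj c x ∧ G.Adj x y ∧ G.Adj y z ∧ y ≠ c ∧ z ≠ c ∧ z ≠ x ∧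
    d ≤ #(G.neighborFinset c \ {x, y, z}) + 1

variable {G : SimpleGraph V} [DecidableRel G.Adj] {H : SimpleGraph W} [DecidableRel H.Adj] {d : ℕ}

theorem HasSpider.tStar_isContained (hd0 : 1 ≤ d) (h : G.HasSpider d) : TStar (d + 3) ⊑ G := by
  obtain ⟨c, x, y, z, hcx, hxy, hyz, hyc, hzc, hzx, hd⟩ := h
  obtain ⟨L, hL, hcard⟩ := exists_subset_card_eq
    (show d - 1 ≤ #(G.neighborFinset c \ {x, y, z}) by omega)
  obtain ⟨g, hinj, hmem⟩ : ∃ g : ℕ → V, (∀ i < d - 1, ∀ j < d - 1, g i = g j → i = j) ∧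
      ∀ i < d - 1, G.Adj c (g i) ∧ g i ≠ x ∧ g i ≠ y ∧ g i ≠ z := by
    -- The value `c` outside the range is never used.
    refine ⟨fun i => if hi : i < d - 1 then ((L.equivFinOfCardEq hcard).symm ⟨i, hi⟩ : V) else c,
      fun i hi j hj hij => ?_, fun i hi => ?_⟩
    · simp only [hi, hj, dif_pos] at hij
      simpa using (Equiv.injective _ (Subtype.val_injective hij))
    · simp only [hi, dif_pos]
      have := hL ((L.equivFinOfCardEq hcard).symm ⟨i, hi⟩).2
      simpa using this
  -- Index 0 is the centre, 1 to d - 1 are the leaves, and d, d + 1, d + 2 run along the leg.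
  let f : ℕ → V := fun i => if i = 0 then c else if i < d then g (i - 1) else
    if i = d then x else if i = d + 1 then y else z
  have f0 : f 0 = c := by simp [f]
  have flt (i : ℕ) (h0 : i ≠ 0) (hi : i < d) : f i = g (i - 1) := by simp [f, h0, hi]
  have fd : f d = x := by simp [f, show d ≠ 0 by omega]
  have fd1 : f (d + 1) = y := by simp [f]
  have fd2 : f (d + 2) = z := by simp [f]
  have hadj (a b : ℕ) (hab : (a = 0 ∧ 1 ≤ b ∧ b + 3 ≤ d + 3) ∨ (a + 3 = d + 3 ∧ b + 2 = d + 3) ∨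
      (a + 2 = d + 3 ∧ b + 1 = d + 3)) : G.Adj (f a) (f b) := by
    rcases hab with ⟨rfl, h1, h2⟩ | ⟨h1, h2⟩ | ⟨h1, h2⟩
    · rcases (show b < d ∨ b = d by omega) with hb | rfl
      · rw [f0, flt b (by omega) hb]; exact (hmem _ (by omega)).1
      · rw [f0, fd]; exact hcx
    · obtain rfl : a = d := by omega
      obtain rfl : b = a + 1 := by omega
      rw [fd, fd1]; exact hxy
    · obtain rfl : a = d + 1 := by omega
      obtain rfl : b = d + 2 := by omega
      rw [fd1, fd2]; exact hyz
  have hne (a b : ℕ) (hab : a < b) (hb : b < d + 3) : f a ≠ f b := by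
    rcases (show a = 0 ∨ (a ≠ 0 ∧ a < d) ∨ a = d ∨ a = d + 1 by omega) with
      rfl | ⟨ha0, had⟩ | rfl | rfl
    · rcases (show b < d ∨ b = d ∨ b = d + 1 ∨ b = d + 2 by omega) with hb | rfl | rfl | rfl
      · rw [f0, flt b (by omega) hb]; exact (hmem _ (by omega)).1.ne
      · rw [f0, fd]; exact hcx.ne
      · rw [f0, fd1]; exact hyc.symm
      · rw [f0, fd2]; exact hzc.symm
    · rw [flt a ha0 had]
      have := hmem (a - 1) (by omega)
      rcases (show b < d ∨ b = d ∨ b = d + 1 ∨ b = d + 2 by omega) with hb | rfl | rfl | rfl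
      · rw [flt b (by omega) hb]
        intro h
        have := hinj _ (by omega) _ (by omega) h
        omega
      · rw [fd]; exact this.2.1
      · rw [fd1]; exact this.2.2.1
      · rw [fd2]; exact this.2.2.2
    · rw [fd]
      rcases (show b = a + 1 ∨ b = a + 2 by omega) with rfl | rfl
      · rw [fd1]; exact hxy.ne
      · rw [fd2]; exact hzx.symm
    · obtain rfl : b = d + 2 := by omega
      rw [fd1, fd2]; exact hyz.ne
  refine ⟨⟨⟨fun i => f i, fun {a b} hab => ?_⟩, fun a b hab => ?_⟩⟩
  · rw [TStar, fromRel_adj] at hab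
    rcases hab.2 with h | h
    · exact hadj a b h
    · exact (hadj b a h).symm
  · by_contra h
    rcases lt_or_gt_of_ne (Fin.val_ne_of_ne h) with h | h
    · exact hne a b h b.2 hab
    · exact hne b a h a.2 hab.symm

theorem hasSpider_of_tStar_isContained (hd0 : 1 ≤ d) (h : TStar (d + 3) ⊑ G) : G.HasSpider d := by
  obtain ⟨f⟩ := h
  have hadj (a b : ℕ) (ha : a < d + 3) (hb : b < d + 3) (hne : a ≠ b)
      (hab : (a = 0 ∧ 1 ≤ b ∧ b + 3 ≤ d + 3) ∨ (a + 3 = d + 3 ∧ b + 2 = d + 3) ∨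
        (a + 2 = d + 3 ∧ b + 1 = d + 3)) : G.Adj (f ⟨a, ha⟩) (f ⟨b, hb⟩) := by
    refine f.toHom.map_adj ?_
    rw [TStar, fromRel_adj]
    exact ⟨by simpa using hne, Or.inl hab⟩
  have hne (a b : ℕ) (ha : a < d + 3) (hb : b < d + 3) (hne : a ≠ b) :
      f ⟨a, ha⟩ ≠ f ⟨b, hb⟩ := fun h => hne (by simpa using f.injective h)
  refine ⟨f ⟨0, by omega⟩, f ⟨d, by omega⟩, f ⟨d + 1, by omega⟩, f ⟨d + 2, by omega⟩,
    hadj _ _ _ _ (by omega) (by omega), hadj _ _ _ _ (by omega) (by omega),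
    hadj _ _ _ _ (by omega) (by omega), hne _ _ _ _ (by omega), hne _ _ _ _ (by omega),
    hne _ _ _ _ (by omega), ?_⟩
  let e : Fin (d - 1) → V := fun i => f ⟨i + 1, by omega⟩
  have he : Function.Injective e := fun i j hij => by
    have := f.injective hij
    ext
    simpa using this
  have hsub : univ.image e ⊆ G.neighborFinset (f ⟨0, by omega⟩) \
      {f ⟨d, by omega⟩, f ⟨d + 1, by omega⟩, f ⟨d + 2, by omega⟩} := by
    intro w hw
    obtain ⟨i, -, rfl⟩ := mem_image.1 hw
    simp only [mem_sdiff, mem_neighborFinset, mem_insert, mem_singleton, not_or]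
    have := i.2
    exact ⟨hadj _ _ _ _ (by omega) (by omega), hne _ _ _ _ (by omega), hne _ _ _ _ (by omega),
      hne _ _ _ _ (by omega)⟩
  have := card_le_card hsub
  rw [card_image_of_injective _ he, card_univ, Fintype.card_fin] at this
  omega

theorem tStar_free_iff (hd0 : 1 ≤ d) : (TStar (d + 3)).Free G ↔ ¬ G.HasSpider d :=
  not_congr ⟨hasSpider_of_tStar_isContained hd0, HasSpider.tStar_isContained hd0⟩

/-- A spider needs x and d - 1 further neighbours of c, which already exhausts the degree. So y and
z are non-neighbours of c, yet adjacent. This criterion certifies the extremal examples. -/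
theorem not_hasSpider_of_degree_le (h1 : ∀ c, G.degree c ≤ d)
    (h2 : ∀ c, G.degree c = d → ∀ y z, ¬ G.Adj c y → ¬ G.Adj c z → ¬ G.Adj y z) :
    ¬ G.HasSpider d := by
  rintro ⟨c, x, y, z, hcx, hxy, hyz, hyc, hzc, hzx, hd⟩
  have hx : x ∈ G.neighborFinset c := by simpa using hcx
  have key (w : V) (hwx : w ≠ x) (hw : w ∈ ({x, y, z} : Finset V)) : ¬ G.Adj c w := by
    intro hcw
    have hsub : G.neighborFinset c \ {x, y, z} ⊆ ((G.neighborFinset c).erase x).erase w := by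
      intro u hu
      simp only [mem_sdiff, mem_erase] at hu ⊢
      refine ⟨?_, ?_, hu.1⟩
      · rintro rfl; exact hu.2 hw
      · rintro rfl; exact hu.2 (by simp)
    have h3 := card_le_card hsub
    have h4 : w ∈ (G.neighborFinset c).erase x := by simp [hwx, hcw]
    have h5 := card_pos.2 ⟨w, h4⟩
    rw [card_erase_of_mem h4] at h3
    rw [card_erase_of_mem hx, card_neighborFinset_eq_degree] at h3 h5
    have := h1 c
    omega
  have hdeg : G.degree c = d := by
    have hsub : G.neighborFinset c \ {x, y, z} ⊆ (G.neighborFinset c).erase x := by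
      intro u hu
      simp only [mem_sdiff, mem_erase, mem_insert, not_or] at hu ⊢
      exact ⟨hu.2.1, hu.1⟩
    have h3 := card_le_card hsub
    have h5 := card_pos.2 ⟨x, hx⟩
    rw [card_erase_of_mem hx] at h3
    rw [card_neighborFinset_eq_degree] at h3 h5
    have := h1 c
    omega
  exact h2 c hdeg y z (key y hxy.ne' (by simp)) (key z hzx (by simp)) hyz

theorem HasSpider.of_sum [DecidableRel (G ⊕g H).Adj] (h : (G ⊕g H).HasSpider d) :
    G.HasSpider d ∨ H.HasSpider d := by
  obtain ⟨c | c, x | x, y | y, z | z, hcx, hxy, hyz, hyc, hzc, hzx, hd⟩ := h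
  any_goals simp at hcx hxy hyz
  · refine Or.inl ⟨c, x, y, z, hcx, hxy, hyz, by simpa using hyc, by simpa using hzc,
      by simpa using hzx, hd.trans (Nat.succ_le_succ ?_)⟩
    rw [← card_map (s := G.neighborFinset c \ {x, y, z}) (Function.Embedding.inl (β := W))]
    refine card_le_card fun w hw => ?_
    rcases w with w | w
    · simpa using hw
    · simp at hw
  · refine Or.inr ⟨c, x, y, z, hcx, hxy, hyz, by simpa using hyc, by simpa using hzc,
      by simpa using hzx, hd.trans (Nat.succ_le_succ ?_)⟩
    rw [← card_map (s := H.neighborFinset c \ {x, y, z}) (Function.Embedding.inr (α := V))]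
    refine card_le_card fun w hw => ?_
    rcases w with w | w
    · simp at hw
    · simpa using hw

end Characterization

/-! ### Degree sums over a ball of radius two -/

section DegreeSums

/-- A finset of vertices is closed if it is a union of connected components. -/
def AdjClosed {V : Type*} (G : SimpleGraph V) (C : Finset V) : Prop :=
  ∀ x ∈ C, ∀ y, G.Adj x y → y ∈ C

theorem AdjClosed.sdiff {V : Type*} [DecidableEq V] {G : SimpleGraph V} {S C : Finset V} (hS : G.AdjClosed S) (hC : G.AdjClosed C) :
    G.AdjClosed (S \ C) := by
  intro x hx y hxy
  rw [mem_sdiff] at hx ⊢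
  exact ⟨hS x hx.1 y hxy, fun hy => hx.2 (hC y hy x hxy.symm)⟩

variable {V : Type*} [Fintype V] [DecidableEq V] {G : SimpleGraph V} [DecidableRel G.Adj] {d : ℕ}

theorem sum_card_neighborFinset_inter_comm (A B : Finset V) :
    ∑ x ∈ A, #(G.neighborFinset x ∩ B) = ∑ y ∈ B, #(G.neighborFinset y ∩ A) := by
  have := sum_card_bipartiteAbove_eq_sum_card_bipartiteBelow (s := A) (t := B) G.Adj
  convert this using 3
  · ext; simp [bipartiteAbove, and_comm]
  · ext; simp [bipartiteBelow, and_comm, G.adj_comm]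

/-- The vertices at distance two from `v`. -/
def secondNeighbors (G : SimpleGraph V) [DecidableRel G.Adj] (v : V) : Finset V :=
  (G.neighborFinset v).biUnion (fun x => G.neighborFinset x) \ insert v (G.neighborFinset v)

theorem mem_secondNeighbors {v y : V} :
    y ∈ G.secondNeighbors v ↔ (∃ x, G.Adj v x ∧ G.Adj x y) ∧ y ≠ v ∧ ¬ G.Adj v y := by
  simp [secondNeighbors]

/-- The ball of radius two around `v`. -/
def ballTwo (G : SimpleGraph V) [DecidableRel G.Adj] (v : V) : Finset V :=
  G.neighborFinset v ∪ insert v (G.secondNeighbors v)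

theorem mem_ballTwo_self (v : V) : v ∈ G.ballTwo v := by simp [ballTwo]

theorem notMem_secondNeighbors_self (v : V) : v ∉ G.secondNeighbors v := by
  simp [mem_secondNeighbors]

theorem disjoint_neighborFinset_insert_secondNeighbors (v : V) :
    Disjoint (G.neighborFinset v) (insert v (G.secondNeighbors v)) := by
  rw [Finset.disjoint_left]
  intro x hx
  have : G.Adj v x := by simpa using hx
  simp [mem_secondNeighbors, this, this.ne']

theorem card_ballTwo (v : V) :
    #(G.ballTwo v) = G.degree v + #(G.secondNeighbors v) + 1 := by
  rw [ballTwo, card_union_of_disjoint (disjoint_neighborFinset_insert_secondNeighbors v),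
    card_insert_of_notMem (notMem_secondNeighbors_self v), card_neighborFinset_eq_degree]
  ring

/-- Non-neighbours at the end of a leg would complete a spider. -/
theorem neighborFinset_subset_of_mem_secondNeighbors (hG : ¬ G.HasSpider d) {v y : V}
    (hv : d ≤ G.degree v) (hy : y ∈ G.secondNeighbors v) :
    G.neighborFinset y ⊆ G.neighborFinset v := by
  obtain ⟨⟨x, hvx, hxy⟩, hyv, hvy⟩ := mem_secondNeighbors.1 hy
  intro z hz
  rw [mem_neighborFinset] at hz ⊢
  by_contra hvz
  refine hG ⟨v, x, y, z, hvx, hxy, hz, hyv, ?_, ?_, ?_⟩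
  · rintro rfl; exact hvy hz.symm
  · rintro rfl; exact hvz hvx
  · have : (G.neighborFinset v).erase x ⊆ G.neighborFinset v \ {x, y, z} := by
      intro w hw
      simp only [mem_erase, mem_neighborFinset, mem_sdiff, mem_insert, mem_singleton] at hw ⊢
      refine ⟨hw.2, ?_⟩
      rintro (rfl | rfl | rfl) <;> tauto
    have h1 := card_le_card this
    rw [card_erase_of_mem (by simpa using hvx), card_neighborFinset_eq_degree] at h1
    omega

theorem adjClosed_ballTwo (hG : ¬ G.HasSpider d) {v : V} (hv : d ≤ G.degree v) :
    G.AdjClosed (G.ballTwo v) := by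
  intro x hx y hxy
  simp only [ballTwo, mem_union, mem_insert, mem_neighborFinset] at hx ⊢
  rcases hx with hx | rfl | hx
  · simp only [mem_secondNeighbors]
    by_cases h1 : G.Adj v y
    · exact Or.inl h1
    · by_cases h2 : y = v
      · exact Or.inr (Or.inl h2)
      · exact Or.inr (Or.inr ⟨⟨x, hx, hxy⟩, h2, h1⟩)
  · exact Or.inl hxy
  · have := neighborFinset_subset_of_mem_secondNeighbors hG hv hx
      ((G.mem_neighborFinset x y).2 hxy)
    exact Or.inl (by simpa using this)

theorem ballTwo_subset {S : Finset V} (hS : G.AdjClosed S) {v : V} (hv : v ∈ S) :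
    G.ballTwo v ⊆ S := by
  intro y hy
  simp only [ballTwo, mem_union, mem_insert, mem_neighborFinset, mem_secondNeighbors] at hy
  rcases hy with hy | rfl | ⟨⟨x, hvx, hxy⟩, -⟩
  · exact hS v hv y hy
  · exact hv
  · exact hS x (hS v hv x hvx) y hxy

/-- The neighbours of a neighbour of `v`, split by distance from `v`. -/
theorem degree_eq_of_adj {v x : V} (hx : x ∈ G.neighborFinset v) :
    G.degree x = #(G.neighborFinset x ∩ G.neighborFinset v) +
      #(G.neighborFinset x ∩ insert v (G.secondNeighbors v)) := by
  rw [← card_union_of_disjoint, ← inter_union_distrib_left, ← card_neighborFinset_eq_degree]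
  · congr 1
    rw [eq_comm, inter_eq_left]
    intro y hy
    simp only [mem_neighborFinset, mem_union, mem_insert, mem_secondNeighbors] at hx hy ⊢
    by_cases h1 : G.Adj v y
    · exact Or.inl h1
    · by_cases h2 : y = v
      · exact Or.inr (Or.inl h2)
      · exact Or.inr (Or.inr ⟨⟨x, hx, hy⟩, h2, h1⟩)
  · exact (disjoint_neighborFinset_insert_secondNeighbors v).mono inter_subset_right
      inter_subset_right

theorem sum_degree_insert_secondNeighbors (hG : ¬ G.HasSpider d) {v : V} (hv : d ≤ G.degree v) :
    ∑ y ∈ insert v (G.secondNeighbors v), G.degree y =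
      ∑ x ∈ G.neighborFinset v, #(G.neighborFinset x ∩ insert v (G.secondNeighbors v)) := by
  rw [sum_card_neighborFinset_inter_comm]
  refine sum_congr rfl fun y hy => ?_
  rw [← card_neighborFinset_eq_degree, eq_comm]
  congr 1
  rw [inter_eq_left]
  rcases mem_insert.1 hy with rfl | hy
  · rfl
  · exact neighborFinset_subset_of_mem_secondNeighbors hG hv hy

/-- The set consisting of v and its second neighbours is independent, with all its edges going to
N(v). An edge between the two sets is therefore seen once from N(v) and must be counted twice. -/
theorem sum_degree_ballTwo (hG : ¬ G.HasSpider d) {v : V} (hv : d ≤ G.degree v) :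
    ∑ x ∈ G.ballTwo v, G.degree x =
      ∑ x ∈ G.neighborFinset v, (#(G.neighborFinset x ∩ G.neighborFinset v) +
        2 * #(G.neighborFinset x ∩ insert v (G.secondNeighbors v))) := by
  rw [ballTwo, sum_union (disjoint_neighborFinset_insert_secondNeighbors v),
    sum_degree_insert_secondNeighbors hG hv, ← sum_add_distrib]
  refine sum_congr rfl fun x hx => ?_
  rw [degree_eq_of_adj hx]
  ring

theorem sum_degree_ballTwo_eq (hG : ¬ G.HasSpider d) {v : V} (hv : d ≤ G.degree v) :
    ∑ x ∈ G.ballTwo v, G.degree x =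
      ∑ x ∈ G.neighborFinset v, #(G.neighborFinset x ∩ G.neighborFinset v) +
        2 * (G.degree v + ∑ y ∈ G.secondNeighbors v, G.degree y) := by
  rw [sum_degree_ballTwo hG hv, sum_add_distrib, ← mul_sum,
    ← sum_degree_insert_secondNeighbors hG hv, sum_insert (notMem_secondNeighbors_self v)]

/-- The spare neighbour of v pays for a leg v - x - y - z that returns to N(v): deleting x and z
still leaves d - 1 neighbours. -/
theorem degree_le_one_of_mem_secondNeighbors (hG : ¬ G.HasSpider d) {v y : V}
    (hv : d + 1 ≤ G.degree v) (hy : y ∈ G.secondNeighbors v) : G.degree y ≤ 1 := by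
  rw [← card_neighborFinset_eq_degree]
  obtain ⟨⟨x, hvx, hxy⟩, hyv, hvy⟩ := mem_secondNeighbors.1 hy
  rw [← card_singleton x]
  refine card_le_card fun z hz => mem_singleton.2 ?_
  rw [mem_neighborFinset] at hz
  by_contra hzx
  refine hG ⟨v, x, y, z, hvx, hxy, hz, hyv, ?_, hzx, ?_⟩
  · rintro rfl; exact hvy hz.symm
  · have : ((G.neighborFinset v).erase x).erase z ⊆ G.neighborFinset v \ {x, y, z} := by
      intro w hw
      simp only [mem_erase, mem_neighborFinset, mem_sdiff, mem_insert, mem_singleton] at hw ⊢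
      refine ⟨hw.2.2, ?_⟩
      rintro (rfl | rfl | rfl) <;> tauto
    have h1 := card_le_card this
    have h2 := pred_card_le_card_erase (s := (G.neighborFinset v).erase x) (a := z)
    rw [card_erase_of_mem (by simpa using hvx), card_neighborFinset_eq_degree] at h2
    omega

theorem sum_degree_secondNeighbors_le (hG : ¬ G.HasSpider d) {v : V}
    (hv : d + 1 ≤ G.degree v) :
    ∑ y ∈ G.secondNeighbors v, G.degree y ≤ #(G.secondNeighbors v) := by
  simpa using sum_le_card_nsmul _ _ 1
    fun y hy => degree_le_one_of_mem_secondNeighbors hG hv hy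

/-- A path x - y - z inside N(v) would leave d - 1 neighbours of v, so N(v) induces a matching;
second neighbours are pendant. -/
theorem sum_degree_ballTwo_le_of_degree_ge (hG : ¬ G.HasSpider d) {v : V}
    (hv : d + 2 ≤ G.degree v) :
    ∑ x ∈ G.ballTwo v, G.degree x + 3 ≤ 3 * #(G.ballTwo v) := by
  have h1 := sum_degree_secondNeighbors_le hG (show d + 1 ≤ G.degree v by omega)
  have h2 : ∑ x ∈ G.neighborFinset v, #(G.neighborFinset x ∩ G.neighborFinset v) ≤
      G.degree v := by
    have : ∀ z ∈ G.neighborFinset v, #(G.neighborFinset z ∩ G.neighborFinset v) ≤ 1 := by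
      intro y hy
      rw [card_le_one]
      intro x hx z hz
      simp only [mem_inter, mem_neighborFinset] at hx hy hz
      by_contra hxz
      refine hG ⟨v, x, y, z, hx.2, hx.1.symm, hz.1, hy.ne', hz.2.ne', Ne.symm hxz, ?_⟩
      have h3 := le_card_sdiff {x, y, z} (G.neighborFinset v)
      have h4 := card_le_three (a := x) (b := y) (c := z)
      rw [card_neighborFinset_eq_degree] at h3
      omega
    simpa using sum_le_card_nsmul _ _ 1 this
  rw [sum_degree_ballTwo_eq hG (show d ≤ G.degree v by omega), card_ballTwo]
  omega

/-- A neighbour x of v that reaches a second neighbour y is isolated within N(v), since w in N(v)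
adjacent to x gives the leg v - w - x - y. Only d vertices of N(v) can carry inner edges. -/
theorem sum_degree_ballTwo_le_of_degree_eq_succ (hG : ¬ G.HasSpider d) {v : V}
    (hv : G.degree v = d + 1) (hY : (G.secondNeighbors v).Nonempty) :
    ∑ x ∈ G.ballTwo v, G.degree x ≤ d * (d - 1) + 2 * (#(G.ballTwo v) - 1) := by
  have h1 := sum_degree_secondNeighbors_le hG (show d + 1 ≤ G.degree v by omega)
  obtain ⟨y, hy⟩ := hY
  obtain ⟨⟨x, hvx, hxy⟩, hyv, hvy⟩ := mem_secondNeighbors.1 hy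
  have hx : ∀ w, G.Adj v w → ¬ G.Adj w x := by
    intro w hvw hwx
    refine hG ⟨v, w, x, y, hvw, hwx, hxy, hvx.ne', hyv, ?_, ?_⟩
    · rintro rfl; exact hvy hvw
    · have : ((G.neighborFinset v).erase x).erase w ⊆ G.neighborFinset v \ {w, x, y} := by
        intro u hu
        simp only [mem_erase, mem_neighborFinset, mem_sdiff, mem_insert, mem_singleton] at hu ⊢
        refine ⟨hu.2.2, ?_⟩
        rintro (rfl | rfl | rfl) <;> tauto
      have h1 := card_le_card this
      have h2 := pred_card_le_card_erase (s := (G.neighborFinset v).erase x) (a := w)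
      rw [card_erase_of_mem (by simpa using hvx), card_neighborFinset_eq_degree] at h2
      omega
  have hxN : x ∈ G.neighborFinset v := by simpa using hvx
  have h2 : ∑ x ∈ G.neighborFinset v, #(G.neighborFinset x ∩ G.neighborFinset v) ≤
      d * (d - 1) := by
    rw [← add_sum_erase _ _ hxN]
    have h0 : #(G.neighborFinset x ∩ G.neighborFinset v) = 0 := by
      rw [card_eq_zero, eq_empty_iff_forall_notMem]
      intro w hw
      simp only [mem_inter, mem_neighborFinset] at hw
      exact hx w hw.2 hw.1.symm
    have hc : #((G.neighborFinset v).erase x) = d := by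
      rw [card_erase_of_mem hxN, card_neighborFinset_eq_degree, hv]; rfl
    rw [h0, zero_add, ← hc, ← smul_eq_mul]
    refine sum_le_card_nsmul _ _ _ fun w hw => ?_
    rw [← card_erase_of_mem hw]
    refine card_le_card fun u hu => ?_
    simp only [mem_inter, mem_erase, mem_neighborFinset] at hu hw ⊢
    refine ⟨hu.1.ne', ?_, hu.2⟩
    rintro rfl
    exact hx w hw.2 hu.1
  rw [sum_degree_ballTwo_eq hG (show d ≤ G.degree v by omega), card_ballTwo]
  omega

/-- If all degrees are at most `d` and `v` has degree `d`, the ball of radius two around `v` is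
either short of one degree at every neighbour of `v`, or contains a complete bipartite graph
that leaves few further edges. -/
theorem sum_degree_ballTwo_le_of_degree_eq (hG : ¬ G.HasSpider d) {v : V}
    (hv : G.degree v = d) (hmax : ∀ x ∈ G.ballTwo v, G.degree x ≤ d) {t : ℕ}
    (ht : #(G.ballTwo v) = d + t) (htd : t ≤ d) :
    ∑ x ∈ G.ballTwo v, G.degree x ≤ d * (d + t - 1) ∨
      ∑ x ∈ G.ballTwo v, G.degree x ≤ 2 * d * (d - t) + 2 * t * t := by
  have hI : #(insert v (G.secondNeighbors v)) = t := by
    rw [card_ballTwo] at ht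
    rw [card_insert_of_notMem (notMem_secondNeighbors_self v)]
    omega
  have hN : #(G.neighborFinset v) = d := by rw [card_neighborFinset_eq_degree, hv]
  have hsub : G.neighborFinset v ⊆ G.ballTwo v := subset_union_left
  rw [sum_degree_ballTwo hG hv.ge]
  generalize hIdef : insert v (G.secondNeighbors v) = I at *
  have ha (x : V) : #(G.neighborFinset x ∩ I) ≤ t := hI ▸ card_le_card inter_subset_right
  have hab (x : V) (hx : x ∈ G.neighborFinset v) :
      #(G.neighborFinset x ∩ G.neighborFinset v) + #(G.neighborFinset x ∩ I) ≤ d := by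
    rw [← hIdef, ← degree_eq_of_adj hx]; exact hmax x (hsub hx)
  -- Each x in N(v) contributes at most d + t, with equality exactly under this condition.
  by_cases hex : ∃ x ∈ G.neighborFinset v, #(G.neighborFinset x ∩ I) = t ∧
      #(G.neighborFinset x ∩ G.neighborFinset v) = d - t
  · right
    obtain ⟨x, hx, hxa, hxb⟩ := hex
    have hdx : G.degree x = d := by
      rw [degree_eq_of_adj hx, hIdef, hxa, hxb]; omega
    set N := G.neighborFinset v with hNdef
    set A := N \ G.neighborFinset x with hA
    set B := N ∩ G.neighborFinset x with hB
    have hBc : #B = d - t := by rw [hB, inter_comm, hxb]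
    have hAc : #A = t := by
      have := card_sdiff_add_card_inter N (G.neighborFinset x)
      rw [← hA, ← hB] at this
      omega
    have hvB : v ∈ G.neighborFinset x := by
      rw [mem_neighborFinset]; simpa [hNdef] using G.adj_comm v x |>.1 (by simpa [hNdef] using hx)
    -- Here x has degree d too, so the distance-two argument applies with x as centre: members of A
    -- other than x are second neighbours of x through v.
    have hAind : ∀ y ∈ A, ∀ z ∈ A, ¬ G.Adj y z := by
      intro y hy z hz hyz
      simp only [hA, hNdef, mem_sdiff, mem_neighborFinset] at hy hz hx hvB
      by_cases hyx : y = x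
      · subst hyx; exact hz.2 hyz
      have hy2 : y ∈ G.secondNeighbors x := mem_secondNeighbors.2 ⟨⟨v, hvB, hy.1⟩, hyx, hy.2⟩
      have := neighborFinset_subset_of_mem_secondNeighbors hG hdx.ge hy2
        ((G.mem_neighborFinset y z).2 hyz)
      exact hz.2 (by simpa using this)
    have hAB : ∀ y ∈ A, #(G.neighborFinset y ∩ N) = #(G.neighborFinset y ∩ B) := by
      intro y hy
      congr 1
      ext z
      simp only [mem_inter, mem_neighborFinset, hB, and_congr_right_iff, iff_self_and]
      intro hyz hz
      by_contra hxz
      exact hAind y hy z (by simp [hA, hz, hxz]) hyz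
    -- As A is independent, its inner edges all go to B and are charged there.
    have hdouble : ∑ y ∈ A, #(G.neighborFinset y ∩ N) ≤ ∑ y ∈ B, #(G.neighborFinset y ∩ N) := by
      rw [sum_congr rfl hAB, sum_card_neighborFinset_inter_comm]
      exact sum_le_sum fun y _ => card_le_card (inter_subset_inter_left sdiff_subset)
    have hsplit (f : V → ℕ) : ∑ y ∈ N, f y = ∑ y ∈ A, f y + ∑ y ∈ B, f y := by
      rw [← sum_union (disjoint_sdiff_inter N _), sdiff_union_inter]
    have h1 : ∑ y ∈ A, #(G.neighborFinset y ∩ I) ≤ t * t := by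
      have := sum_le_card_nsmul A (fun y => #(G.neighborFinset y ∩ I)) t fun y _ => ha y
      rwa [hAc, smul_eq_mul] at this
    have h2 : ∑ y ∈ B, (#(G.neighborFinset y ∩ N) + #(G.neighborFinset y ∩ I)) ≤ (d - t) * d := by
      have := sum_le_card_nsmul B
        (fun y => #(G.neighborFinset y ∩ N) + #(G.neighborFinset y ∩ I)) d
        fun y hy => hab y (inter_subset_left hy)
      rwa [hBc, smul_eq_mul] at this
    rw [hsplit]
    simp only [sum_add_distrib, ← mul_sum] at h2 ⊢
    nlinarith
  · left
    calc _ ≤ #(G.neighborFinset v) • (d + t - 1) := by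
          refine sum_le_card_nsmul _ _ _ fun x hx => ?_
          have h1 := ha x
          have h2 := hab x hx
          by_contra h3
          exact hex ⟨x, hx, by omega, by omega⟩
      _ = _ := by rw [hN, smul_eq_mul]

/-- Every edge of the ball meets the d vertices of N(v), each of degree at most d. -/
theorem sum_degree_ballTwo_le_two_mul_sq (hG : ¬ G.HasSpider d) {v : V}
    (hv : G.degree v = d) (hmax : ∀ x ∈ G.ballTwo v, G.degree x ≤ d) :
    ∑ x ∈ G.ballTwo v, G.degree x ≤ 2 * d * d := by
  rw [sum_degree_ballTwo hG hv.ge]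
  have : ∀ x ∈ G.neighborFinset v, #(G.neighborFinset x ∩ G.neighborFinset v) +
        2 * #(G.neighborFinset x ∩ insert v (G.secondNeighbors v)) ≤ 2 * d := by
    intro x hx
    have h1 := degree_eq_of_adj hx
    have h2 := hmax x (subset_union_left hx)
    omega
  have := sum_le_card_nsmul _ _ _ this
  rw [card_neighborFinset_eq_degree, hv, smul_eq_mul] at this
  linarith

end DegreeSums

/-! ### Arithmetic of the defect -/

section ExtremalNumber

/-- The defect for a number of vertices of residue `r` modulo `d + 2`; `big` says whether there
are enough vertices for a component other than a complete graph. -/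
def residueDefect (d r : ℕ) (big : Bool) : ℕ :=
  if big ∧ d = 5 ∧ r = 3 then 10
  else if big ∧ d = 6 ∧ r = 4 then 12
  else if big ∧ d = 7 ∧ r = 5 then 14
  else if big ∧ d = 7 ∧ r = 4 then 18
  else r * (d + 2 - r)

/-- The amount by which twice the extremal number of `TStar (d + 3)` on `s` vertices falls short
of `(d + 1) * s`. -/
def spiderDefect (d s : ℕ) : ℕ := residueDefect d (s % (d + 2)) (decide (d + 3 ≤ s))


theorem residueDefect_add_le {d : ℕ} (hd3 : 3 ≤ d) (hd7 : d ≤ 7) {a b : ℕ} (ha : a < d + 2)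
    (hb : b < d + 2) {f f₁ f₂ : Bool} (h₁ : f₁ → f) (h₂ : f₂ → f) :
    residueDefect d ((a + b) % (d + 2)) f ≤ residueDefect d a f₁ + residueDefect d b f₂ := by
  have key : ∀ d ∈ Finset.Icc 3 7, ∀ a ∈ range (d + 2), ∀ b ∈ range (d + 2), ∀ f f₁ f₂ : Bool,
      (f₁ → f) → (f₂ → f) →
      residueDefect d ((a + b) % (d + 2)) f ≤ residueDefect d a f₁ + residueDefect d b f₂ := by
    decide +kernel
  exact key d (by simp [hd3, hd7]) a (by simpa) b (by simpa) f f₁ f₂ h₁ h₂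

theorem spiderDefect_add_le {d : ℕ} (hd3 : 3 ≤ d) (hd7 : d ≤ 7) (a b : ℕ) :
    spiderDefect d (a + b) ≤ spiderDefect d a + spiderDefect d b := by
  rw [spiderDefect, Nat.add_mod]
  refine residueDefect_add_le hd3 hd7 (Nat.mod_lt _ (by omega)) (Nat.mod_lt _ (by omega)) ?_ ?_ <;>
  · simp only [decide_eq_true_eq]; omega

theorem four_mul_spiderDefect_le {d : ℕ} (hd3 : 3 ≤ d) (hd7 : d ≤ 7) (s : ℕ) :
    4 * spiderDefect d s ≤ (d + 2) ^ 2 := by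
  have key : ∀ d ∈ Finset.Icc 3 7, ∀ a ∈ range (d + 2), ∀ f : Bool,
      4 * residueDefect d a f ≤ (d + 2) ^ 2 := by
    decide +kernel
  exact key d (by simp [hd3, hd7]) _ (mem_range.2 (Nat.mod_lt _ (by omega))) _

theorem mul_pred_add_spiderDefect {d : ℕ} (hd3 : 3 ≤ d) (hd7 : d ≤ 7) {s : ℕ} (hs : s ≤ d + 2) :
    s * (s - 1) + spiderDefect d s = (d + 1) * s := by
  have key : ∀ d ∈ Finset.Icc 3 7, ∀ s ∈ range (d + 3),
      s * (s - 1) + spiderDefect d s = (d + 1) * s := by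
    decide +kernel
  exact key d (by simp [hd3, hd7]) s (mem_range.2 (by omega))

theorem add_spiderDefect_le_of_ballTwo_bounds {d : ℕ} (hd3 : 3 ≤ d) (hd7 : d ≤ 7) {t D : ℕ}
    (ht : 3 ≤ t) (h1 : D ≤ (d + t) * d) (h2 : D ≤ 2 * d * d)
    (h3 : t ≤ d → D ≤ d * (d + t - 1) ∨ D ≤ 2 * d * (d - t) + 2 * t * t) :
    D + spiderDefect d (d + t) ≤ (d + 1) * (d + t) := by
  rcases le_or_gt t d with h | h
  · have key : ∀ d ∈ Finset.Icc 3 7, ∀ t ∈ Finset.Icc 3 d,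
        min (min ((d + t) * d) (2 * d * d))
          (max (d * (d + t - 1)) (2 * d * (d - t) + 2 * t * t)) + spiderDefect d (d + t) ≤
        (d + 1) * (d + t) := by
      decide +kernel
    refine le_trans ?_ (key d (by simp [hd3, hd7]) t (by simp [ht, h]))
    exact Nat.add_le_add_right (le_min (le_min h1 h2) (le_max_iff.2 (h3 h))) _
  -- For t > d the bound 2d² leaves slack at least 3d + 1, which exceeds (d + 2)²/4 in this range.
  · have := four_mul_spiderDefect_le hd3 hd7 (d + t)
    interval_cases d <;> omega

/-! ### Upper bound by peeling off closed sets -/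

variable {V : Type*} [Fintype V] [DecidableEq V] {G : SimpleGraph V} [DecidableRel G.Adj] {d : ℕ}

theorem AdjClosed.sum_degree_le {C : Finset V} (hC : G.AdjClosed C) :
    ∑ x ∈ C, G.degree x ≤ #C * (#C - 1) := by
  rw [← smul_eq_mul]
  refine sum_le_card_nsmul _ _ _ fun x hx => ?_
  rw [← card_erase_of_mem hx, ← card_neighborFinset_eq_degree]
  refine card_le_card fun y hy => ?_
  rw [mem_neighborFinset] at hy
  exact mem_erase.2 ⟨hy.ne', hC x hx y hy⟩

theorem exists_adjClosed_sum_degree_le (hd3 : 3 ≤ d) (hd7 : d ≤ 7) (hG : ¬ G.HasSpider d)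
    {S : Finset V} (hS : G.AdjClosed S) (hne : S.Nonempty) :
    ∃ C ⊆ S, C.Nonempty ∧ G.AdjClosed C ∧
      ∑ x ∈ C, G.degree x + spiderDefect d #C ≤ (d + 1) * #C := by
  have small {C : Finset V} (hC : G.AdjClosed C) (hc : #C ≤ d + 2) :
      ∑ x ∈ C, G.degree x + spiderDefect d #C ≤ (d + 1) * #C :=
    (mul_pred_add_spiderDefect hd3 hd7 hc) ▸ Nat.add_le_add_right hC.sum_degree_le _
  have bound := four_mul_spiderDefect_le hd3 hd7
  by_cases hbig : ∃ v ∈ S, d ≤ G.degree v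
  · obtain ⟨v, hv, hmaxv⟩ := exists_max_image S (fun x => G.degree x) hne
    have hvd : d ≤ G.degree v := by
      obtain ⟨w, hw, hwd⟩ := hbig
      exact hwd.trans (hmaxv w hw)
    have hB := adjClosed_ballTwo hG hvd
    have hBS := ballTwo_subset hS hv
    refine ⟨G.ballTwo v, hBS, ⟨v, mem_ballTwo_self v⟩, hB, ?_⟩
    rcases le_or_gt #(G.ballTwo v) (d + 2) with hs | hs
    · exact small hB hs
    have hb := bound #(G.ballTwo v)
    rcases (show d + 2 ≤ G.degree v ∨ G.degree v = d + 1 ∨ G.degree v = d by omega) with h | h | h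
    · have := sum_degree_ballTwo_le_of_degree_ge hG h
      interval_cases d <;> omega
    · have hY : (G.secondNeighbors v).Nonempty := by
        rw [← card_pos]
        rw [card_ballTwo] at hs
        omega
      have := sum_degree_ballTwo_le_of_degree_eq_succ hG h hY
      interval_cases d <;> omega
    · have hmax : ∀ x ∈ G.ballTwo v, G.degree x ≤ d := fun x hx => h ▸ hmaxv x (hBS hx)
      obtain ⟨t, ht⟩ := Nat.exists_eq_add_of_le (show d ≤ #(G.ballTwo v) by omega)
      have h1 := sum_le_card_nsmul _ _ _ hmax
      have h2 := sum_degree_ballTwo_le_two_mul_sq hG h hmax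
      have h3 := sum_degree_ballTwo_le_of_degree_eq hG h hmax ht
      rw [ht] at h1 hs ⊢
      exact add_spiderDefect_le_of_ballTwo_bounds hd3 hd7 (by omega) h1 h2 h3
  · push Not at hbig
    refine ⟨S, subset_rfl, hne, hS, ?_⟩
    rcases le_or_gt #S (d + 2) with hs | hs
    · exact small hS hs
    -- The slack is 2|S| ≥ 2(d + 3), against a defect of at most (d + 2)²/4; for d = 7 this is 20
    -- against 20 after rounding down.
    have h1 := sum_le_card_nsmul S (fun x => G.degree x) (d - 1) fun x hx => by
      exact Nat.le_sub_one_of_lt (hbig x hx)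
    have hb := bound #S
    rw [smul_eq_mul] at h1
    interval_cases d <;> omega

theorem AdjClosed.sum_degree_add_spiderDefect_le (hd3 : 3 ≤ d) (hd7 : d ≤ 7)
    (hG : ¬ G.HasSpider d) (S : Finset V) (hS : G.AdjClosed S) :
    ∑ x ∈ S, G.degree x + spiderDefect d #S ≤ (d + 1) * #S := by
  induction S using Finset.strongInduction with
  | H S ih =>
    rcases S.eq_empty_or_nonempty with rfl | hne
    · simp [spiderDefect, residueDefect]
    obtain ⟨C, hCS, hCne, hC, hle⟩ := exists_adjClosed_sum_degree_le hd3 hd7 hG hS hne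
    have h1 := ih (S \ C) (sdiff_ssubset hCS hCne) (hS.sdiff hC)
    have h2 := sum_sdiff hCS (f := fun x => G.degree x)
    have h3 := card_sdiff_add_card_eq_card hCS
    have h4 := spiderDefect_add_le hd3 hd7 #(S \ C) #C
    rw [h3] at h4
    rw [← h2]
    calc _ ≤ (d + 1) * #(S \ C) + (d + 1) * #C := by omega
      _ = (d + 1) * #S := by rw [← mul_add, h3]

theorem two_mul_extremalNumber_tStar_le (hd3 : 3 ≤ d) (hd7 : d ≤ 7) (p : ℕ) :
    2 * extremalNumber p (TStar (d + 3)) + spiderDefect d p ≤ (d + 1) * p := by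
  classical
  have key : ∀ ⦃G : SimpleGraph (Fin p)⦄ [DecidableRel G.Adj], (TStar (d + 3)).Free G →
      2 * #G.edgeFinset + spiderDefect d p ≤ (d + 1) * p := by
    intro G _ hG
    have := AdjClosed.sum_degree_add_spiderDefect_le hd3 hd7
      ((tStar_free_iff (by omega)).1 hG) univ fun _ _ _ _ => mem_univ _
    rwa [sum_degrees_eq_twice_card_edges, card_univ, Fintype.card_fin] at this
  -- The empty graph shows that the truncated subtraction below loses nothing.
  have h0 : spiderDefect d p ≤ (d + 1) * p := by
    have := AdjClosed.sum_degree_add_spiderDefect_le (G := (⊥ : SimpleGraph (Fin p))) hd3 hd7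
      (by rintro ⟨_, _, _, _, h, -⟩; exact h) univ fun _ _ _ _ => mem_univ _
    rw [card_univ, Fintype.card_fin] at this
    omega
  have : extremalNumber (Fintype.card (Fin p)) (TStar (d + 3)) ≤
      ((d + 1) * p - spiderDefect d p) / 2 := by
    rw [extremalNumber_le_iff]
    intro G _ hG
    have := key hG
    omega
  rw [Fintype.card_fin] at this
  omega

/-! ### Constructions and the lower bound -/

theorem tStar_ne_bot (hd : 1 ≤ d) : TStar (d + 3) ≠ ⊥ := by
  intro h
  have : (TStar (d + 3)).Adj ⟨0, by omega⟩ ⟨d, by omega⟩ := by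
    rw [TStar, fromRel_adj]
    refine ⟨?_, Or.inl (Or.inl ⟨rfl, hd, le_rfl⟩)⟩
    simp only [ne_eq, Fin.mk.injEq]
    omega
  rw [h] at this
  exact this

theorem extremalNumber_tStar_add_le (hd : 1 ≤ d) (a b : ℕ) :
    extremalNumber a (TStar (d + 3)) + extremalNumber b (TStar (d + 3)) ≤
      extremalNumber (a + b) (TStar (d + 3)) := by
  classical
  obtain ⟨G, _, hG⟩ := exists_isExtremal_free (V := Fin a) (tStar_ne_bot hd)
  obtain ⟨H, _, hH⟩ := exists_isExtremal_free (V := Fin b) (tStar_ne_bot hd)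
  have h1 := card_edgeFinset_of_isExtremal_free hG
  have h2 := card_edgeFinset_of_isExtremal_free hH
  rw [Fintype.card_fin] at h1 h2
  have hfree : (TStar (d + 3)).Free (G ⊕g H) := by
    rw [tStar_free_iff hd]
    intro h
    rcases h.of_sum with h | h
    · exact (tStar_free_iff hd).1 hG.prop h
    · exact (tStar_free_iff hd).1 hH.prop h
  have h3 := card_edgeFinset_le_extremalNumber hfree
  have h4 : #(G ⊕g H).edgeFinset = #G.edgeFinset + #H.edgeFinset := by
    rw [edgeFinset_card, edgeFinset_card, edgeFinset_card, ← Fintype.card_sum]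
    exact Fintype.card_congr edgeSetSumEquiv
  rw [h4, h1, h2] at h3
  simpa using h3

theorem mul_pred_le_two_mul_extremalNumber_tStar {s : ℕ} (hs : s ≤ d + 2) :
    s * (s - 1) ≤ 2 * extremalNumber s (TStar (d + 3)) := by
  classical
  have hfree : (TStar (d + 3)).Free (⊤ : SimpleGraph (Fin s)) := by
    rintro ⟨f⟩
    have := Fintype.card_le_of_injective f f.injective
    simp at this
    omega
  have h := card_edgeFinset_le_extremalNumber hfree
  rw [card_edgeFinset_top_eq_card_choose_two, Fintype.card_fin, Nat.choose_two_right] at h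
  have := Nat.even_mul_pred_self s
  obtain ⟨k, hk⟩ := this
  omega

theorem sq_le_extremalNumber_tStar (hd : 1 ≤ d) :
    d * d ≤ extremalNumber (2 * d) (TStar (d + 3)) := by
  classical
  have hdeg : ∀ c, (completeBipartiteGraph (Fin d) (Fin d)).degree c = d := by
    rintro (c | c) <;> rw [← card_neighborFinset_eq_degree]
    · have : (completeBipartiteGraph (Fin d) (Fin d)).neighborFinset (Sum.inl c) =
        univ.map Function.Embedding.inr := by
        ext (w | w) <;> simp
      rw [this]; simp
    · have : (completeBipartiteGraph (Fin d) (Fin d)).neighborFinset (Sum.inr c) =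
        univ.map Function.Embedding.inl := by
        ext (w | w) <;> simp
      rw [this]; simp
  have hfree : (TStar (d + 3)).Free (completeBipartiteGraph (Fin d) (Fin d)) := by
    rw [tStar_free_iff hd]
    refine not_hasSpider_of_degree_le (fun c => (hdeg c).le) ?_
    rintro (c | c) - (y | y) (z | z) <;> simp
  have h := card_edgeFinset_le_extremalNumber hfree
  have h2 := sum_degrees_eq_twice_card_edges (completeBipartiteGraph (Fin d) (Fin d))
  simp only [hdeg, sum_const, card_univ, Fintype.card_sum, Fintype.card_fin, smul_eq_mul] at h h2
  rw [two_mul d]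
  nlinarith

/-- The complete bipartite graph with parts of six and seven vertices and one further edge inside
the larger part. -/
def bipartiteAddEdge : SimpleGraph (Fin 13) :=
  fromRel fun i j => (i < 6 ∧ 6 ≤ j) ∨ (i = 6 ∧ j = 7)

instance : DecidableRel bipartiteAddEdge.Adj := fun i j =>
  inferInstanceAs (Decidable (i ≠ j ∧ (((i < 6 ∧ 6 ≤ j) ∨ (i = 6 ∧ j = 7)) ∨
    ((j < 6 ∧ 6 ≤ i) ∨ (j = 6 ∧ i = 7)))))

theorem le_extremalNumber_tStar_thirteen : 43 ≤ extremalNumber 13 (TStar (7 + 3)) := by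
  have hfree : (TStar (7 + 3)).Free bipartiteAddEdge := by
    rw [tStar_free_iff (by norm_num)]
    refine not_hasSpider_of_degree_le ?_ ?_ <;> decide +kernel
  have h := card_edgeFinset_le_extremalNumber hfree
  have h2 := sum_degrees_eq_twice_card_edges bipartiteAddEdge
  have h3 : ∑ v, bipartiteAddEdge.degree v = 86 := by decide +kernel
  rw [Fintype.card_fin] at h
  omega

/-- Adding a K_{d+2}, which has defect 0, keeps the residue. The defect can drop only where the size
flag switches on at an exceptional residue, and those are the excluded sizes, where a new graph is
needed. -/
theorem spiderDefect_sub {d s : ℕ} (hs : d + 2 < s) (h1 : ¬ (5 ≤ d ∧ s = 2 * d))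
    (h2 : ¬ (d = 7 ∧ s = 13)) (hd3 : 3 ≤ d) (hd7 : d ≤ 7) :
    spiderDefect d (s - (d + 2)) ≤ spiderDefect d s := by
  rcases le_or_gt (d + 3) (s - (d + 2)) with h | h
  · rw [spiderDefect, spiderDefect, ← Nat.mod_eq_sub_mod (by omega)]
    simp [h, show d + 3 ≤ s by omega]
  · have key : ∀ d ∈ Finset.Icc 3 7, ∀ s ∈ Finset.Icc (d + 3) (2 * d + 4),
        ¬ (5 ≤ d ∧ s = 2 * d) → ¬ (d = 7 ∧ s = 13) →
        spiderDefect d (s - (d + 2)) ≤ spiderDefect d s := by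
      decide +kernel
    exact key d (by simp [hd3, hd7]) s (by simp; omega) h1 h2

theorem le_two_mul_extremalNumber_tStar (hd3 : 3 ≤ d) (hd7 : d ≤ 7) (p : ℕ) :
    (d + 1) * p ≤ 2 * extremalNumber p (TStar (d + 3)) + spiderDefect d p := by
  induction p using Nat.strong_induction_on with
  | _ p ih =>
    rcases le_or_gt p (d + 2) with hp | hp
    · rw [← mul_pred_add_spiderDefect hd3 hd7 hp]
      exact Nat.add_le_add_right (mul_pred_le_two_mul_extremalNumber_tStar hp) _
    by_cases h1 : 5 ≤ d ∧ p = 2 * d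
    · obtain ⟨h5, rfl⟩ := h1
      have := sq_le_extremalNumber_tStar (d := d) (by omega)
      have key : ∀ d ∈ Finset.Icc 5 7,
          (d + 1) * (2 * d) = 2 * (d * d) + spiderDefect d (2 * d) := by
        decide +kernel
      have := key d (by simp [h5, hd7])
      omega
    by_cases h2 : d = 7 ∧ p = 13
    · obtain ⟨rfl, rfl⟩ := h2
      have := le_extremalNumber_tStar_thirteen
      have : spiderDefect 7 13 = 18 := by decide +kernel
      omega
    have h3 := ih (p - (d + 2)) (by omega)
    have h4 := spiderDefect_sub hp h1 h2 hd3 hd7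
    have h5 := mul_pred_le_two_mul_extremalNumber_tStar (d := d) (s := d + 2) le_rfl
    have h6 := extremalNumber_tStar_add_le (d := d) (by omega) (p - (d + 2)) (d + 2)
    rw [Nat.sub_add_cancel hp.le] at h6
    obtain ⟨q, rfl⟩ := Nat.exists_eq_add_of_le' hp.le
    simp only [Nat.add_sub_cancel] at *
    calc (d + 1) * (q + (d + 2)) = (d + 1) * q + (d + 2) * (d + 2 - 1) := by
          rw [show d + 2 - 1 = d + 1 by omega]; ring
      _ ≤ _ := by omega

theorem two_mul_extremalNumber_tStar (hd3 : 3 ≤ d) (hd7 : d ≤ 7) (p : ℕ) :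
    2 * extremalNumber p (TStar (d + 3)) + spiderDefect d p = (d + 1) * p :=
  le_antisymm (two_mul_extremalNumber_tStar_le hd3 hd7 p)
    (le_two_mul_extremalNumber_tStar hd3 hd7 p)

end ExtremalNumber

end SimpleGraph

/-! ### Reading off the cases with d = n - 3 -/

theorem theorem4p5 (n p r : ℕ) (hn6 : 6 ≤ n) (hn10 : n ≤ 10) (hpn : n ≤ p)
    (hr : r ≤ n - 2) (hpr : p ≡ r [MOD (n - 1)]) :
    ((n = 6 ∨ n = 7) →
      (SimpleGraph.extremalNumber p (TStar n) : ℚ)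
        = (((n : ℚ) - 2) * p - r * ((n : ℚ) - 1 - r)) / 2) ∧
    ((n = 8 ∨ n = 9) →
      (r ≠ n - 5 →
        (SimpleGraph.extremalNumber p (TStar n) : ℚ)
          = (((n : ℚ) - 2) * p - r * ((n : ℚ) - 1 - r)) / 2) ∧
      (r = n - 5 →
        (SimpleGraph.extremalNumber p (TStar n) : ℚ)
          = ((n : ℚ) - 2) * ((p : ℚ) - 2) / 2 + 1)) ∧
    (n = 10 →
      (r ≠ 4 ∧ r ≠ 5 →
        (SimpleGraph.extremalNumber p (TStar n) : ℚ)
          = 4 * (p : ℚ) - r * (9 - (r : ℚ)) / 2) ∧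
      (r = 5 →
        (SimpleGraph.extremalNumber p (TStar n) : ℚ) = 4 * (p : ℚ) - 7) ∧
      (r = 4 →
        (SimpleGraph.extremalNumber p (TStar n) : ℚ) = 4 * (p : ℚ) - 9)) := by
  obtain ⟨d, rfl⟩ := Nat.exists_eq_add_of_le' (show 3 ≤ n by omega)
  have key := SimpleGraph.two_mul_extremalNumber_tStar (d := d) (by omega) (by omega) p
  have hmod : p % (d + 2) = r := by
    have : p % (d + 2) = r % (d + 2) := hpr
    rw [this, Nat.mod_eq_of_lt (by omega)]
  rw [SimpleGraph.spiderDefect, hmod, decide_eq_true hpn] at key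
  generalize SimpleGraph.extremalNumber p (TStar (d + 3)) = e at *
  have key' : (2 : ℚ) * e + (SimpleGraph.residueDefect d r true : ℕ) = (d + 1) * p := by
    exact_mod_cast key
  have generic (h : ¬ (d = 5 ∧ r = 3) ∧ ¬ (d = 6 ∧ r = 4) ∧ ¬ (d = 7 ∧ r = 5) ∧
      ¬ (d = 7 ∧ r = 4)) : (e : ℚ) = ((d + 1) * p - r * (d + 2 - r)) / 2 := by
    rw [SimpleGraph.residueDefect, if_neg (by simp [h.1]), if_neg (by simp [h.2.1]),
      if_neg (by simp [h.2.2.1]), if_neg (by simp [h.2.2.2]), Nat.cast_mul, Nat.cast_sub (by omega)] at key'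
    push_cast at key'
    linarith
  have hcast : ((d + 3 : ℕ) : ℚ) = d + 3 := by push_cast; ring
  rw [hcast]
  refine ⟨fun hn => ?_, fun hn => ⟨fun h => ?_, fun h => ?_⟩, fun hn => ⟨fun h => ?_, fun h => ?_,
    fun h => ?_⟩⟩
  · rw [generic (by omega)]; ring
  · rw [generic (by omega)]; ring
  · rcases hn with hn | hn
    · obtain rfl : d = 5 := by omega
      obtain rfl : r = 3 := by omega
      norm_num [SimpleGraph.residueDefect] at key' ⊢
      linarith
    · obtain rfl : d = 6 := by omega
      obtain rfl : r = 4 := by omega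
      norm_num [SimpleGraph.residueDefect] at key' ⊢
      linarith
  · obtain rfl : d = 7 := by omega
    rw [generic (by omega)]
    push_cast
    ring
  · obtain rfl : d = 7 := by omega
    subst h
    norm_num [SimpleGraph.residueDefect] at key' ⊢
    linarith
  · obtain rfl : d = 7 := by omega
    subst h
    norm_num [SimpleGraph.residueDefect] at key' ⊢
    linarith
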